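/- **Setting.** Let $L\ge 2$ and let $I$ be the input dimension. On a probability space let $W^{(\ell)}_{ij}$, $B^{(\ell)}_i$ ($1\le \ell\le L+1$; $i,j\in\mathbb N$) be mutually independent real random variables. Let $\mu_{\alpha,\sigma}$ denote the symmetric $\alpha$-stable law on $\mathbb R$ with scale $\sigma$, i.e. the probability measure with characteristic function $t\mapsto e^{-|\sigma t|^{\alpha}}$. For each layer $\ell$: * the $W^{(\ell)}_{ij}$ are identically distributed and symmetric, and either (a) $\mathbb P(|W^{(\ell)}_{ij}|>t)=t^{-\alpha_\ell}L^{(\ell)}(t)$ for all $t>0$, with $\alpha_\ell\in(0,2]$ and $L^{(\ell)}$ slowly varying, or (b) $\mathbb E|W^{(\ell)}_{ij}|^2<\infty$ and $\alpha_\ell=2$; * $B^{(\ell)}_i\sim\mu_{\alpha_\ell,\sigma_{B^{(\ell)}}}$ with $\sigma_{B^{(\ell)}}>0$. Put $L^{(\ell)}_0=L^{(\ell)}$ if $\alpha_\ell<2$ and $L_0^{(\ell)}(x)=\int_0^x y\,\mathbb P(|W^{(\ell)}_{ij}|>y)\,dy$ if $\alpha_\ell=2$, and $a_m(\ell)=\inf\{t>0: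 t^{-\alpha_\ell}L^{(\ell)}_0(t)\le m^{-1}\}$. Let $\phi:\mathbb R\to\mathbb R$ be continuous and bounded and let $\mathbf x\in\mathbb R^I$. For $\mathbf n=(n_1,\dots,n_L)$ with all $n_k\ge 2$ and all $i\in\mathbb N$ set $$Y^{(1)}_i=\sum_{j=1}^I W^{(1)}_{ij}x_j+B^{(1)}_i,\qquad Y^{(\ell)}_i(\mathbf x;\mathbf n)=\frac1{a_{n_{\ell-1}}(\ell)}\sum_{j=1}^{n_{\ell-1}}W^{(\ell)}_{ij}\,\phi\big(Y^{(\ell-1)}_j(\mathbf x;\mathbf n)\big)+B^{(\ell)}_i\quad(2\le\ell\le L+1)$$ (with the convention $1/0=0$ should $a_{n_{\ell-1}}(\ell)=0$). Let $c_\alpha=\lim_{M\to\infty}\int_0^M u^{-\alpha}\sin u\,du$ for $\alpha<2$ and $c_2=1$, and define $\sigma_\ell\ge 0$ by $$\sigma_2^{\alpha_2}=\sigma_{B^{(2)}}^{\alpha_2}+c_{\alpha_2}\int|\phi|^{\alpha_2}\,d\nu^{(1)},\qquad \sigma_\ell^{\alpha_\ell}=\sigma_{B^{(\ell)}}^{\alpha_\ell}+c_{\alpha_\ell}\int|\phi|^{\alpha_\ell}\,d\mu_{\alpha_{\ell-1},\sigma_{\ell-1}}\quad(3\le\ell\le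 L+1),$$ where $\nu^{(1)}$ is the law of $Y^{(1)}_1$. **Statement.** Let $3\le\ell\le L+1$. The law $\mu_{\alpha_{\ell-1},\sigma_{\ell-1}}$ exists. For each $\mathbf n$ with all $n_k\ge2$ the sequence $(Y^{(\ell-1)}_i(\mathbf x;\mathbf n))_{i\ge1}$ is exchangeable and has a directing random measure, i.e. a random probability measure $\xi^{(\ell-1)}(\cdot;\mathbf n)$ on $\mathbb R$ given which the $Y^{(\ell-1)}_i(\mathbf x;\mathbf n)$, $i\ge 1$, are i.i.d. with law $\xi^{(\ell-1)}(\cdot;\mathbf n)$. For any choice of these directing random measures, the following are equivalent as $\min(n_1,\dots,n_L)\to\infty$: 1. the joint law of $(Y^{(\ell-1)}_i(\mathbf x;\mathbf n))_{i\ge1}$ converges weakly, on $\mathbb R^{\mathbb N}$, to $\bigotimes_{i\ge1}\mu_{\alpha_{\ell-1},\sigma_{\ell-1}}$; 2. $\xi^{(\ell-1)}(\cdot;\mathbf n)$ converges weakly, in probability, to $\mu_{\alpha_{\ell-1},\sigma_{\ell-1}}$, i.e. $\mathbb P\big(\xi^{(\ell-1)}(\cdot;\mathbf n)\notin U\big)\to0$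 for every neighbourhood $U$ of $\mu_{\alpha_{\ell-1},\sigma_{\ell-1}}$ in the weak topology on the probability measures on $\mathbb R$. -/

import Mathlib

open MeasureTheory ProbabilityTheory Filter Topology

noncomputable section

namespace HeavyMLP

/-- `L` is slowly varying (at infinity); only its values on `(0, ∞)` matter. -/
structure SlowlyVarying (L : ℝ → ℝ) : Prop where
  measurable : Measurable (fun t : Set.Ioi (0 : ℝ) => L t)
  pos : ∀ t, 0 < t → 0 < L t
  tendsto : ∀ r : ℝ, 0 < r → Tendsto (fun t => L (r * t) / L t) atTop (𝓝 1)

/-- `μ` is a symmetric `α`-stable law with scale parameter `σ`: its characteristic function is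
`t ↦ exp (-|σ t| ^ α)`. -/
def IsSymStable (α σ : ℝ) (μ : Measure ℝ) : Prop :=
  ∀ t : ℝ, charFun μ t = ((Real.exp (-(|σ * t| ^ α)) : ℝ) : ℂ)

open Classical in
/-- The symmetric `α`-stable law `μ_{α,σ}`: the probability measure on `ℝ` whose characteristic
function is `t ↦ exp (-|σ t| ^ α)`. It is unique; it exists for `0 < α ≤ 2` and `0 ≤ σ`, and
the point mass at `0` (`default`) is returned when there is no such measure. -/
def stableLaw (α σ : ℝ) : ProbabilityMeasure ℝ :=
  if h : ∃ μ : ProbabilityMeasure ℝ, IsSymStable α σ (μ : Measure ℝ) then h.choose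
  else default

/-- `c_α = lim_{M → ∞} ∫_0^M sin u / u ^ α du` for `α < 2`, and `c_2 = 1`. -/
def cConst (α : ℝ) : ℝ :=
  if α < 2 then limUnder atTop (fun M : ℝ => ∫ u in (0 : ℝ)..M, Real.sin u / u ^ α) else 1

/-- A random initialization of a multi-layer perceptron with `L` hidden layers, input dimension
`I`, input `x` and bounded continuous activation `φ`. Layers are numbered `1, …, L + 1`; all
data attached to other layer numbers is irrelevant. Nodes within a layer are numbered from `0`,
and every layer is extended to infinitely many nodes. `slow ℓ` is the slowly varying function of
the weights of layer `ℓ` (irrelevant if they are not heavy-tailed). -/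
structure Setting {Ω : Type*} [MeasurableSpace Ω] (P : Measure Ω) (L I : ℕ) where
  /-- stability index of each layer -/
  α : ℕ → ℝ
  /-- slowly varying function of each layer -/
  slow : ℕ → ℝ → ℝ
  /-- scale of the biases of each layer -/
  σB : ℕ → ℝ
  /-- weights `W ℓ i j`, on the edge from node `j` of layer `ℓ - 1` to node `i` of layer `ℓ` -/
  W : ℕ → ℕ → ℕ → Ω → ℝ
  /-- biases `B ℓ i` -/
  B : ℕ → ℕ → Ω → ℝ
  /-- activation function -/
  φ : ℝ → ℝ
  /-- input -/
  x : Fin I → ℝ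
  measurable_W : ∀ ℓ ∈ Set.Icc 1 (L + 1), ∀ i j, Measurable (W ℓ i j)
  measurable_B : ∀ ℓ ∈ Set.Icc 1 (L + 1), ∀ i, Measurable (B ℓ i)
  /-- all weights and biases of all layers are mutually independent -/
  indep : iIndepFun
    (fun p : Set.Icc 1 (L + 1) × (ℕ × ℕ ⊕ ℕ) =>
      Sum.elim (fun q : ℕ × ℕ => W p.1 q.1 q.2) (fun i : ℕ => B p.1 i) p.2) P
  identDistrib_W : ∀ ℓ ∈ Set.Icc 1 (L + 1), ∀ i j, IdentDistrib (W ℓ i j) (W ℓ 0 0) P P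
  symm_W : ∀ ℓ ∈ Set.Icc 1 (L + 1), ∀ i j,
    IdentDistrib (fun ω => -W ℓ i j ω) (W ℓ i j) P P
  /-- in each layer, the weights are heavy-tailed with index `α ℓ ∈ (0, 2]`, or they have a finite
  second moment and `α ℓ = 2` -/
  tail_W : ∀ ℓ ∈ Set.Icc 1 (L + 1),
    (0 < α ℓ ∧ α ℓ ≤ 2 ∧ SlowlyVarying (slow ℓ) ∧
      ∀ t : ℝ, 0 < t → P.real {ω | t < |W ℓ 0 0 ω|} = t ^ (-α ℓ) * slow ℓ t) ∨
    (α ℓ = 2 ∧ Integrable (fun ω => |W ℓ 0 0 ω| ^ 2) P)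
  σB_pos : ∀ ℓ ∈ Set.Icc 1 (L + 1), 0 < σB ℓ
  law_B : ∀ ℓ ∈ Set.Icc 1 (L + 1), ∀ i, IsSymStable (α ℓ) (σB ℓ) (P.map (B ℓ i))
  continuous_φ : Continuous φ
  bounded_φ : ∃ C : ℝ, ∀ y, |φ y| ≤ C

namespace Setting

variable {Ω : Type*} [MeasurableSpace Ω] {P : Measure Ω} {L I : ℕ}

/-- `L̃ (x) = ∫_0^x y P(|W| > y) dy` for the weights of layer `ℓ`. -/
def Ltilde (S : Setting P L I) (ℓ : ℕ) (x : ℝ) : ℝ :=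
  ∫ y in (0 : ℝ)..x, y * P.real {ω | y < |S.W ℓ 0 0 ω|}

/-- `L₀`, equal to the slowly varying function of layer `ℓ` if `α ℓ < 2` and to `L̃` if
`α ℓ = 2`. -/
def L0 (S : Setting P L I) (ℓ : ℕ) : ℝ → ℝ :=
  if S.α ℓ < 2 then S.slow ℓ else S.Ltilde ℓ

/-- The normalization `a_m(ℓ) = inf {t > 0 : t ^ (-α_ℓ) L₀(t) ≤ 1 / m}`. -/
def a (S : Setting P L I) (ℓ m : ℕ) : ℝ :=
  sInf {t : ℝ | 0 < t ∧ t ^ (-S.α ℓ) * S.L0 ℓ t ≤ (m : ℝ)⁻¹}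

/-- The width `n_ℓ` of hidden layer `ℓ ∈ {1, …, L}`, for the vector of widths
`n = (n_1, …, n_L)` (indexed from `0` in Lean). -/
def width (n : Fin L → ℕ) (ℓ : ℕ) : ℕ :=
  if h : ℓ - 1 < L then n ⟨ℓ - 1, h⟩ else 0

/-- The pre-activation values of the first layer. -/
def firstLayer (S : Setting P L I) (i : ℕ) (ω : Ω) : ℝ :=
  ∑ j : Fin I, S.W 1 i j ω * S.x j + S.B 1 i ω

/-- The pre-activation values `Y n ℓ i` of layers `ℓ = 1, …, L + 1`, for widths `n` and all nodes
`i ∈ ℕ`. The value at `ℓ = 0` is a dummy. -/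
def Y (S : Setting P L I) (n : Fin L → ℕ) : ℕ → ℕ → Ω → ℝ
  | 0 => fun _ _ => 0
  | 1 => S.firstLayer
  | ℓ + 2 => fun i ω =>
      1 / S.a (ℓ + 2) (width n (ℓ + 1)) *
          ∑ j ∈ Finset.range (width n (ℓ + 1)), S.W (ℓ + 2) i j ω * S.φ (Y S n (ℓ + 1) j ω)
        + S.B (ℓ + 2) i ω

/-- The limiting scales `σ_ℓ`, `ℓ = 2, …, L + 1`. The values at `ℓ = 0, 1` are dummies. -/
def σ (S : Setting P L I) : ℕ → ℝ
  | 0 => 0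
  | 1 => 0
  | 2 => (S.σB 2 ^ S.α 2 +
        cConst (S.α 2) * ∫ y, |S.φ y| ^ S.α 2 ∂(P.map (S.firstLayer 0))) ^ (1 / S.α 2)
  | ℓ + 3 => (S.σB (ℓ + 3) ^ S.α (ℓ + 3) +
        cConst (S.α (ℓ + 3)) * ∫ y, |S.φ y| ^ S.α (ℓ + 3)
          ∂(stableLaw (S.α (ℓ + 2)) (σ S (ℓ + 2)) : Measure ℝ)) ^ (1 / S.α (ℓ + 3))

end Setting

/-- A sequence of real random variables is exchangeable if its joint law is invariant under all
finite permutations of the indices. -/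
def Exchangeable {Ω : Type*} [MeasurableSpace Ω] (P : Measure Ω) (X : ℕ → Ω → ℝ) : Prop :=
  ∀ π : Equiv.Perm ℕ, {i | π i ≠ i}.Finite →
    P.map (fun ω i => X (π i) ω) = P.map (fun ω i => X i ω)

/-- `ξ` is a directing random measure of the sequence `X`: a random probability measure given
which the `X i` are i.i.d. with law `ξ`, that is, for all finite sets `s` of indices and all
Borel sets `A i`, almost surely `P(X i ∈ A i for all i ∈ s | ξ) = ∏_{i ∈ s} ξ(A i)`. -/
structure IsDirecting {Ω : Type*} [MeasurableSpace Ω] (P : Measure Ω) (X : ℕ → Ω → ℝ)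
    (ξ : Ω → ProbabilityMeasure ℝ) : Prop where
  measurable : Measurable ξ
  condIID : ∀ (s : Finset ℕ) (A : ℕ → Set ℝ), (∀ i, MeasurableSet (A i)) →
    P⟦⋂ i ∈ s, X i ⁻¹' A i | MeasurableSpace.comap ξ inferInstance⟧
      =ᵐ[P] fun ω => ∏ i ∈ s, (ξ ω : Measure ℝ).real (A i)

/-- Random probability measures `ξ n` converge weakly, in probability, to the deterministic `μ`:
convergence in probability in the space of probability measures on `ℝ` with its weak topology
(the topology of `ProbabilityMeasure ℝ`). As the limit is deterministic, this reads: for every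
neighbourhood `U` of `μ`, the probability that `ξ n` is outside `U` tends to `0`. -/
def TendstoWeaklyInProb {Ω ι : Type*} [MeasurableSpace Ω] (P : Measure Ω)
    (ξ : ι → Ω → ProbabilityMeasure ℝ) (l : Filter ι) (μ : ProbabilityMeasure ℝ) : Prop :=
  ∀ U ∈ 𝓝 μ, Tendsto (fun n => P {ω | ξ n ω ∉ U}) l (𝓝 0)

/-- The filter `min (n_1, …, n_L) → ∞` on the vectors of widths. -/
def minWidthToInfinity (L : ℕ) : Filter (Fin L → ℕ) :=
  ⨅ N : ℕ, 𝓟 {n | ∀ k, N ≤ n k}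

end HeavyMLP

end

/-! The equivalence is a general fact about conditionally i.i.d. sequences `X i` with directing
measure `ξ` and a deterministic candidate limit `μ`; the normalization and the formula for the
limiting scale play no role. From 1 to 2: for bounded continuous `f` with `c = ∫ f dμ`, conditional
independence gives `E (ξ(f) - c)² = E (f(X 0) - c)(f(X 1) - c)` (`IsDirecting.integral_sub_sq`). The
right side tends to zero when the limit is a product, and Chebyshev's inequality concludes. From 2
to 1: `P(X i ∈ A i, i ∈ s) = E ∏ ξ(A i)` is the mean of a bounded functional of `ξ`, continuous at
`μ` if the `A i` have `μ`-null frontiers; boxes with such sides determine weak convergence on `ℝ^ℕ`.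
Directing measures exist because the nodes of a layer apply one map to the common previous layer and
to their own i.i.d. inputs (`isDirecting_of_indepFun`). The stable law is a rescaled bias law. -/

noncomputable section

namespace HeavyMLP

/-! ### Moments of a directing random measure. -/

section Directing

variable {Ω : Type*} [MeasurableSpace Ω] {P : Measure Ω} [IsProbabilityMeasure P]
  {X : ℕ → Ω → ℝ} {ξ : Ω → ProbabilityMeasure ℝ}

lemma measurable_real_apply {A : Set ℝ} (hA : MeasurableSet A) :
    Measurable fun ν : ProbabilityMeasure ℝ => (ν : Measure ℝ).real A :=
  ((Measure.measurable_coe hA).comp measurable_subtype_coe).ennreal_toReal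

lemma IsDirecting.measureReal_iInter (h : IsDirecting P X ξ) (hX : ∀ i, Measurable (X i))
    (s : Finset ℕ) {A : ℕ → Set ℝ} (hA : ∀ i, MeasurableSet (A i)) :
    P.real (⋂ i ∈ s, X i ⁻¹' A i) = ∫ ω, ∏ i ∈ s, (ξ ω : Measure ℝ).real (A i) ∂P := by
  rw [← integral_congr_ae (h.condIID s A hA), integral_condExp h.measurable.comap_le,
    integral_indicator (Finset.measurableSet_biInter s fun i _ => hX i (hA i))]
  simp

/-- The directing random measure as a Markov kernel. -/
def IsDirecting.kernel (h : IsDirecting P X ξ) : Kernel Ω ℝ where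
  toFun ω := ξ ω
  measurable' := measurable_subtype_coe.comp h.measurable

omit [IsProbabilityMeasure P] in
lemma IsDirecting.kernel_apply (h : IsDirecting P X ξ) (ω : Ω) :
    h.kernel ω = (ξ ω : Measure ℝ) := rfl

instance (h : IsDirecting P X ξ) : IsMarkovKernel h.kernel :=
  ⟨fun ω => inferInstanceAs (IsProbabilityMeasure (ξ ω : Measure ℝ))⟩

/-- Rectangles determine a measure on the plane, so the defining property on Borel sets suffices;
the kernel form then yields integrals of general test functions. -/
lemma IsDirecting.map_pair_eq (h : IsDirecting P X ξ) (hX : ∀ i, Measurable (X i)) :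
    P.map (fun ω => (X 0 ω, X 1 ω)) = P.bind (h.kernel ×ₖ h.kernel) := by
  have hm : Measurable fun ω => (X 0 ω, X 1 ω) := (hX 0).prodMk (hX 1)
  have : IsProbabilityMeasure (P.map fun ω => (X 0 ω, X 1 ω)) :=
    Measure.isProbabilityMeasure_map hm.aemeasurable
  refine Measure.ext_prod fun {A B} hA hB => ?_
  rw [Measure.bind_apply (hA.prod hB) (Kernel.aemeasurable _),
    Measure.map_apply hm (hA.prod hB)]
  have hAB : ∀ i : ℕ, MeasurableSet (if i = 0 then A else B) := fun i => by
    split_ifs <;> assumption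
  have key := h.measureReal_iInter hX {0, 1} hAB
  have hset : (⋂ i ∈ ({0, 1} : Finset ℕ), X i ⁻¹' (if i = 0 then A else B))
      = (fun ω => (X 0 ω, X 1 ω)) ⁻¹' A ×ˢ B := by
    ext ω; simp
  rw [hset] at key
  rw [← ofReal_measureReal, key, ofReal_integral_eq_lintegral_ofReal]
  · refine lintegral_congr fun ω => ?_
    rw [Kernel.prod_apply, Measure.prod_prod]
    simp [ENNReal.ofReal_mul, h.kernel_apply]
  · refine Integrable.of_bound (C := 1) (Measurable.aestronglyMeasurable ?_) (ae_of_all _ fun ω => ?_)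
    · exact Finset.measurable_prod _ fun i _ => (measurable_real_apply (hAB i)).comp h.measurable
    · rw [Real.norm_of_nonneg (Finset.prod_nonneg fun _ _ => measureReal_nonneg)]
      exact Finset.prod_le_one (fun _ _ => measureReal_nonneg) fun _ _ => measureReal_le_one
  · exact ae_of_all _ fun ω => Finset.prod_nonneg fun _ _ => measureReal_nonneg

lemma IsDirecting.integral_mul (h : IsDirecting P X ξ) (hX : ∀ i, Measurable (X i))
    {f g : ℝ → ℝ} (hf : Continuous f) (hg : Continuous g) {C D : ℝ}
    (hfC : ∀ y, |f y| ≤ C) (hgD : ∀ y, |g y| ≤ D) :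
    ∫ ω, f (X 0 ω) * g (X 1 ω) ∂P
      = ∫ ω, (∫ y, f y ∂(ξ ω : Measure ℝ)) * ∫ y, g y ∂(ξ ω : Measure ℝ) ∂P := by
  have hm : Measurable fun ω => (X 0 ω, X 1 ω) := (hX 0).prodMk (hX 1)
  have hcont : Continuous fun p : ℝ × ℝ => f p.1 * g p.2 := by fun_prop
  calc ∫ ω, f (X 0 ω) * g (X 1 ω) ∂P
      = ∫ p, f p.1 * g p.2 ∂(P.map fun ω => (X 0 ω, X 1 ω)) :=
        (integral_map hm.aemeasurable hcont.aestronglyMeasurable).symm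
    _ = _ := by
        have hint : Integrable (fun p : ℝ × ℝ => f p.1 * g p.2)
            (P.map fun ω => (X 0 ω, X 1 ω)) := by
          have := Measure.isProbabilityMeasure_map (μ := P) hm.aemeasurable
          refine Integrable.of_bound (C := C * D) hcont.aestronglyMeasurable
            (ae_of_all _ fun p => ?_)
          rw [norm_mul]
          exact mul_le_mul (hfC _) (hgD _) (norm_nonneg _) ((abs_nonneg _).trans (hfC p.1))
        rw [h.map_pair_eq hX] at hint ⊢
        rw [Measure.comp_eq_comp_const_apply] at hint ⊢
        rw [Kernel.integral_comp hint, Kernel.const_apply]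
        refine integral_congr_ae (ae_of_all _ fun ω => ?_)
        simp only [Kernel.prod_apply]
        rw [integral_prod_mul]
        rfl

omit [IsProbabilityMeasure P] in
lemma IsDirecting.measurable_integral (h : IsDirecting P X ξ) {f : ℝ → ℝ} (hf : Continuous f) :
    Measurable fun ω => ∫ y, f y ∂(ξ ω : Measure ℝ) :=
  (hf.stronglyMeasurable.integral_kernel (κ := h.kernel)).measurable

/-- The second moment of the centered integral of a test function against a directing random
measure. -/
lemma IsDirecting.integral_sub_sq (h : IsDirecting P X ξ) (hX : ∀ i, Measurable (X i))
    {f : ℝ → ℝ} (hf : Continuous f) {C : ℝ} (hC : ∀ y, |f y| ≤ C) (c : ℝ) :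
    ∫ ω, ((∫ y, f y ∂(ξ ω : Measure ℝ)) - c) ^ 2 ∂P
      = ∫ ω, (f (X 0 ω) - c) * (f (X 1 ω) - c) ∂P := by
  have hb : ∀ y, |f y - c| ≤ C + |c| := fun y =>
    (abs_sub _ _).trans (by gcongr; exact hC y)
  rw [h.integral_mul hX (f := fun y => f y - c) (g := fun y => f y - c)
    (by fun_prop) (by fun_prop) hb hb]
  refine integral_congr_ae (ae_of_all _ fun ω => ?_)
  have : ∫ y, f y - c ∂(ξ ω : Measure ℝ) = (∫ y, f y ∂(ξ ω : Measure ℝ)) - c := by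
    rw [integral_sub _ (integrable_const c)]
    · simp
    · exact Integrable.of_bound hf.aestronglyMeasurable C (ae_of_all _ hC)
  simp only [this, sq]

end Directing

/-! ### The equivalence for general conditionally i.i.d. sequences. -/

section Equivalence

variable {Ω ι : Type*} [MeasurableSpace Ω] {P : Measure Ω} [IsProbabilityMeasure P]
  {X : ι → ℕ → Ω → ℝ} {ξ : ι → Ω → ProbabilityMeasure ℝ} {l : Filter ι}
  {μ : ProbabilityMeasure ℝ}

/-- The sets that contain `ξ n` with probability tending to one. -/
def probFilter (P : Measure Ω) (ξ : ι → Ω → ProbabilityMeasure ℝ) (l : Filter ι) :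
    Filter (ProbabilityMeasure ℝ) where
  sets := {U | Tendsto (fun n => P {ω | ξ n ω ∉ U}) l (𝓝 0)}
  univ_sets := by simp [tendsto_const_nhds]
  sets_of_superset {U V} hU hUV := tendsto_of_tendsto_of_tendsto_of_le_of_le tendsto_const_nhds
    hU (fun _ => zero_le) fun _ => measure_mono fun _ hω h => hω (hUV h)
  inter_sets {U V} hU hV := by
    refine tendsto_of_tendsto_of_tendsto_of_le_of_le tendsto_const_nhds
      (by simpa using Tendsto.add hU hV) (fun _ => zero_le) fun n => ?_
    refine (measure_mono fun ω hω => ?_).trans (measure_union_le _ _)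
    simpa [Set.mem_inter_iff, imp_iff_not_or] using hω

omit [IsProbabilityMeasure P] in
-- Convergence in probability to a constant is ordinary convergence of `id` along `probFilter`, so
-- the test-function criterion for weak convergence applies directly to that filter.
lemma tendstoWeaklyInProb_iff :
    TendstoWeaklyInProb P ξ l μ ↔ ∀ f : BoundedContinuousFunction ℝ ℝ, ∀ ε > 0,
      Tendsto (fun n => P {ω | ε ≤ |∫ y, f y ∂(ξ n ω : Measure ℝ) - ∫ y, f y ∂(μ : Measure ℝ)|})
        l (𝓝 0) := by
  have h1 : TendstoWeaklyInProb P ξ l μ ↔ Tendsto id (probFilter P ξ l) (𝓝 μ) := Iff.rfl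
  rw [h1, ProbabilityMeasure.tendsto_iff_forall_integral_tendsto]
  refine forall_congr' fun f => ?_
  rw [Metric.tendsto_nhds]
  refine forall₂_congr fun ε _ => ?_
  change Tendsto _ _ _ ↔ _
  simp [Real.dist_eq]

lemma tendstoWeaklyInProb_of_tendstoInDistribution
    (hX : ∀ n i, Measurable (X n i)) (hξ : ∀ᶠ n in l, IsDirecting P (X n) (ξ n))
    (h : TendstoInDistribution (fun n ω i => X n i ω) l (id : (ℕ → ℝ) → (ℕ → ℝ)) (fun _ => P)
      (Measure.infinitePi fun _ : ℕ => (μ : Measure ℝ))) :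
    TendstoWeaklyInProb P ξ l μ := by
  rw [tendstoWeaklyInProb_iff]
  intro f ε hε
  set c := ∫ y, f y ∂(μ : Measure ℝ) with hc
  have hfC : ∀ y, |f y| ≤ ‖f‖ := fun y => f.norm_coe_le_norm y
  -- Two coordinates suffice: the mean of `F` under the law of `X n` is the second moment of `ξ n
  -- (f) - c`.
  let F : BoundedContinuousFunction (ℕ → ℝ) ℝ :=
    BoundedContinuousFunction.ofNormedAddCommGroup (fun x => (f (x 0) - c) * (f (x 1) - c))
      (by fun_prop) ((‖f‖ + |c|) * (‖f‖ + |c|)) fun x => by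
        have hb : ∀ y, |f y - c| ≤ ‖f‖ + |c| := fun y =>
          (abs_sub _ _).trans (by gcongr; exact hfC y)
        rw [norm_mul]
        exact mul_le_mul (hb _) (hb _) (norm_nonneg _) (by positivity)
  have hlim := ProbabilityMeasure.tendsto_iff_forall_integral_tendsto.1 h.tendsto F
  have h0 : ∫ x, F x ∂((Measure.infinitePi fun _ : ℕ => (μ : Measure ℝ)).map id) = 0 := by
    rw [Measure.map_id]
    change ∫ x : ℕ → ℝ, (f (x 0) - c) * (f (x 1) - c) ∂_ = 0
    have hm : Measurable fun x : ℕ → ℝ => (x 0, x 1) := by fun_prop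
    have := integral_map (μ := Measure.infinitePi fun _ : ℕ => (μ : Measure ℝ)) hm.aemeasurable
      (f := fun p : ℝ × ℝ => (f p.1 - c) * (f p.2 - c))
      (Continuous.aestronglyMeasurable (by fun_prop))
    -- Under the product measure the two coordinates are independent, and each factor has mean zero.
    rw [← this, Measure.infinitePi_map_eval_prod zero_ne_one,
      integral_prod_mul (fun y => f y - c) (fun y => f y - c)]
    have h0 : ∫ y, f y - c ∂(μ : Measure ℝ) = 0 := by
      rw [integral_sub (f.integrable _) (integrable_const c)]
      simp [hc]
    simp [h0]
  simp only [ProbabilityMeasure.coe_mk] at hlim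
  rw [h0] at hlim
  have hlim' : Tendsto (fun n => ENNReal.ofReal
      ((∫ ω, (f (X n 0 ω) - c) * (f (X n 1 ω) - c) ∂P) / ε ^ 2)) l (𝓝 0) := by
    have : Tendsto (fun n => (∫ ω, (f (X n 0 ω) - c) * (f (X n 1 ω) - c) ∂P) / ε ^ 2) l
        (𝓝 (0 / ε ^ 2)) := by
      refine Tendsto.div_const (hlim.congr fun n => ?_) _
      rw [integral_map (measurable_pi_lambda _ (hX n)).aemeasurable
        F.continuous.aestronglyMeasurable]
      rfl
    simpa using ENNReal.tendsto_ofReal this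
  refine tendsto_of_tendsto_of_tendsto_of_le_of_le' tendsto_const_nhds hlim'
    (Eventually.of_forall fun _ => zero_le) ?_
  filter_upwards [hξ] with n hn
  rw [← hn.integral_sub_sq (hX n) f.continuous hfC c]
  have hmeas := hn.measurable_integral f.continuous
  have hint : Integrable (fun ω => ((∫ y, f y ∂(ξ n ω : Measure ℝ)) - c) ^ 2) P := by
    refine Integrable.of_bound (C := (‖f‖ + |c|) ^ 2)
      (Measurable.aestronglyMeasurable (by fun_prop)) (ae_of_all _ fun ω => ?_)
    rw [norm_pow]
    gcongr
    refine (norm_sub_le _ _).trans ?_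
    gcongr
    · simpa using norm_integral_le_of_norm_le_const (μ := (ξ n ω : Measure ℝ))
        (ae_of_all _ f.norm_coe_le_norm)
    · rfl
  have hmarkov := mul_meas_ge_le_integral_of_nonneg (μ := P)
    (ae_of_all _ fun ω => sq_nonneg ((∫ y, f y ∂(ξ n ω : Measure ℝ)) - c)) hint (ε ^ 2)
  rw [← ofReal_measureReal]
  refine ENNReal.ofReal_le_ofReal ?_
  rw [le_div_iff₀' (by positivity)]
  refine le_trans (le_of_eq ?_) hmarkov
  congr 2
  ext ω
  simp only [Set.mem_ofPred_eq]
  rw [← sq_abs ((∫ y, f y ∂(ξ n ω : Measure ℝ)) - c), sq_le_sq₀ hε.le (abs_nonneg _)]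

/-- Bounded convergence: the error is below `ε / 2` off an event `T` of probability below `ε / 2`,
and at most one on it. Continuity is asked at `μ` only, since evaluation on a set with `μ`-null
frontier need not be continuous elsewhere. -/
lemma tendsto_integral_of_tendstoWeaklyInProb (h : TendstoWeaklyInProb P ξ l μ)
    {G : ProbabilityMeasure ℝ → ℝ} (hG : ContinuousAt G μ) (h0 : ∀ ν, 0 ≤ G ν) (h1 : ∀ ν, G ν ≤ 1)
    (hm : ∀ᶠ n in l, Measurable fun ω => G (ξ n ω)) :
    Tendsto (fun n => ∫ ω, G (ξ n ω) ∂P) l (𝓝 (G μ)) := by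
  rw [Metric.tendsto_nhds]
  intro ε hε
  have hU : {ν | |G ν - G μ| < ε / 2} ∈ 𝓝 μ := by
    exact Metric.continuousAt_iff'.1 hG (ε / 2) (half_pos hε)
  have hlt := (h _ hU).eventually_lt_const (ENNReal.ofReal_pos.2 (half_pos hε))
  filter_upwards [hm, hlt] with n hn hPn
  set T := {ω | ξ n ω ∉ {ν | |G ν - G μ| < ε / 2}} with hT
  have hTm : MeasurableSet T := by
    have : Measurable fun ω => |G (ξ n ω) - G μ| := measurable_norm.comp (hn.sub_const _)
    exact (measurableSet_lt this measurable_const).compl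
  have hint : Integrable (fun ω => G (ξ n ω)) P :=
    Integrable.of_bound hn.aestronglyMeasurable (C := 1)
      (ae_of_all _ fun ω => by rw [Real.norm_of_nonneg (h0 _)]; exact h1 _)
  have hle : ∀ ω, |G (ξ n ω) - G μ| ≤ ε / 2 + T.indicator 1 ω := by
    intro ω
    by_cases hω : ω ∈ T
    · rw [Set.indicator_of_mem hω, Pi.one_apply, abs_le]
      constructor <;> linarith [h0 (ξ n ω), h1 (ξ n ω), h0 μ, h1 μ]
    · rw [Set.indicator_of_notMem hω, add_zero]
      exact (not_not.1 hω : |G (ξ n ω) - G μ| < ε / 2).le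
  have hPr : P.real T < ε / 2 := by
    rw [measureReal_def]
    exact (ENNReal.lt_ofReal_iff_toReal_lt (measure_ne_top _ _)).1 hPn
  have hind : Integrable (T.indicator (1 : Ω → ℝ)) P := (integrable_const 1).indicator hTm
  calc dist (∫ ω, G (ξ n ω) ∂P) (G μ) = |∫ ω, (G (ξ n ω) - G μ) ∂P| := by
        rw [integral_sub hint (integrable_const _), Real.dist_eq]; simp
    _ ≤ ∫ ω, |G (ξ n ω) - G μ| ∂P := abs_integral_le_integral_abs
    _ ≤ ∫ ω, (ε / 2 + T.indicator 1 ω) ∂P :=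
        integral_mono (hint.sub (integrable_const _)).abs ((integrable_const _).add hind) hle
    _ = ε / 2 + P.real T := by
        rw [integral_add (integrable_const _) hind, integral_indicator_one hTm]; simp
    _ < ε := by linarith

/-- The finite-dimensional boxes whose sides have `μ`-null frontiers. -/
def nullFrontierBoxes (μ : Measure ℝ) : Set (Set (ℕ → ℝ)) :=
  {t | ∃ (s : Finset ℕ) (A : ℕ → Set ℝ), t = (s : Set ℕ).pi A ∧
    (∀ i, MeasurableSet (A i)) ∧ ∀ i, μ (frontier (A i)) = 0}

lemma isPiSystem_nullFrontierBoxes (μ : Measure ℝ) : IsPiSystem (nullFrontierBoxes μ) := by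
  classical
  rintro - ⟨s, A, rfl, hA, hA0⟩ - ⟨s', A', rfl, hA', hA0'⟩ -
  -- A side that one box leaves unconstrained becomes `univ`, whose frontier is empty.
  refine ⟨s ∪ s', fun i => (if i ∈ s then A i else Set.univ) ∩ (if i ∈ s' then A' i else Set.univ),
    ?_, fun i => ?_, fun i => ?_⟩
  · ext x
    simp only [Set.mem_inter_iff, Set.mem_pi, Finset.coe_union, Set.mem_union, Finset.mem_coe]
    constructor
    · rintro ⟨h, h'⟩ i -
      constructor <;> split_ifs with hi
      exacts [h i hi, trivial, h' i hi, trivial]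
    · intro h
      refine ⟨fun i hi => ?_, fun i hi => ?_⟩
      · simpa [hi] using (h i (Or.inl hi)).1
      · simpa [hi] using (h i (Or.inr hi)).2
  · refine MeasurableSet.inter ?_ ?_ <;> split_ifs
    exacts [hA i, .univ, hA' i, .univ]
  · refine null_frontier_inter ?_ ?_ <;> split_ifs
    exacts [hA0 i, by simp, hA0' i, by simp]

/-- Arbitrarily small radii give balls with null frontier, so the sides of a basic open box can be
shrunk to such balls. -/
lemma exists_nullFrontierBox (μ : Measure ℝ) [SFinite μ] {u : Set (ℕ → ℝ)} (hu : IsOpen u)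
    {x : ℕ → ℝ} (hx : x ∈ u) : ∃ t ∈ nullFrontierBoxes μ, t ∈ 𝓝 x ∧ t ⊆ u := by
  obtain ⟨s, v, hv, hvu⟩ := isOpen_pi_iff.1 hu x hx
  have H : ∀ i, ∃ r, 0 < r ∧ (i ∈ s → Metric.ball (x i) r ⊆ v i) ∧
      μ (frontier (Metric.ball (x i) r)) = 0 := by
    intro i
    obtain ⟨ε, hε, hball⟩ : ∃ ε > 0, i ∈ s → Metric.ball (x i) ε ⊆ v i := by
      by_cases hi : i ∈ s
      · obtain ⟨ε, hε, hb⟩ := Metric.isOpen_iff.1 (hv i hi).1 _ (hv i hi).2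
        exact ⟨ε, hε, fun _ => hb⟩
      · exact ⟨1, one_pos, fun h => absurd h hi⟩
    obtain ⟨r, hr, hr0⟩ := exists_null_frontier_thickening μ {x i} hε
    rw [Metric.thickening_singleton] at hr0
    exact ⟨r, hr.1, fun hi => (Metric.ball_subset_ball hr.2.le).trans (hball hi), hr0⟩
  choose r hr hrv hr0 using H
  refine ⟨(s : Set ℕ).pi fun i => Metric.ball (x i) (r i),
    ⟨s, _, rfl, fun _ => measurableSet_ball, hr0⟩, ?_, ?_⟩
  · exact set_pi_mem_nhds s.finite_toSet fun i _ => Metric.ball_mem_nhds _ (hr i)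
  · exact (Set.pi_mono fun i hi => hrv i hi).trans hvu

lemma tendstoInDistribution_of_tendstoWeaklyInProb [l.IsCountablyGenerated]
    (hX : ∀ n i, Measurable (X n i)) (hξ : ∀ᶠ n in l, IsDirecting P (X n) (ξ n))
    (h : TendstoWeaklyInProb P ξ l μ) :
    TendstoInDistribution (fun n ω i => X n i ω) l (id : (ℕ → ℝ) → (ℕ → ℝ)) (fun _ => P)
      (Measure.infinitePi fun _ : ℕ => (μ : Measure ℝ)) where
  forall_aemeasurable n := (measurable_pi_lambda _ (hX n)).aemeasurable
  aemeasurable_limit := aemeasurable_id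
  tendsto := by
    refine (isPiSystem_nullFrontierBoxes (μ : Measure ℝ)).tendsto_probabilityMeasure_of_tendsto_of_mem
      ?_ (fun u hu x hx => exists_nullFrontierBox _ hu hx) ?_
    · rintro - ⟨s, A, rfl, hA, -⟩
      exact MeasurableSet.pi s.countable_toSet fun i _ => hA i
    · rintro - ⟨s, A, rfl, hA, hA0⟩
      -- By the portmanteau theorem each factor is continuous at `μ`, its set having a `μ`-null
      -- frontier.
      have hG : ContinuousAt
          (fun ν : ProbabilityMeasure ℝ => ∏ i ∈ s, (ν : Measure ℝ).real (A i)) μ := by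
        refine tendsto_finsetProd _ fun i _ => ?_
        have := ProbabilityMeasure.tendsto_measure_of_null_frontier_of_tendsto
          (tendsto_id (x := 𝓝 μ)) (E := A i) (by simpa using hA0 i)
        simp_rw [ProbabilityMeasure.measureReal_eq_coe_coeFn]
        exact (NNReal.continuous_coe.tendsto _).comp this
      have := tendsto_integral_of_tendstoWeaklyInProb h hG
        (fun ν => Finset.prod_nonneg fun _ _ => measureReal_nonneg)
        (fun ν => Finset.prod_le_one (fun _ _ => measureReal_nonneg) fun _ _ => measureReal_le_one)
        (hξ.mono fun n hn => Finset.measurable_prod _ fun i _ =>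
          (measurable_real_apply (hA i)).comp hn.measurable)
      have hbox : MeasurableSet ((s : Set ℕ).pi A) :=
        MeasurableSet.pi s.countable_toSet fun i _ => hA i
      rw [← NNReal.tendsto_coe]
      change Tendsto (fun n => (P.map fun ω i => X n i ω).real ((s : Set ℕ).pi A)) l
        (𝓝 (((Measure.infinitePi fun _ : ℕ => (μ : Measure ℝ)).map id).real ((s : Set ℕ).pi A)))
      rw [Measure.map_id]
      have hlim : (Measure.infinitePi fun _ : ℕ => (μ : Measure ℝ)).real ((s : Set ℕ).pi A)
          = ∏ i ∈ s, (μ : Measure ℝ).real (A i) := by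
        rw [measureReal_def, Measure.infinitePi_pi _ fun i _ => hA i, ENNReal.toReal_prod]
        rfl
      rw [hlim]
      refine this.congr' (hξ.mono fun n hn => ?_)
      beta_reduce
      rw [← hn.measureReal_iInter (hX n) s hA,
        map_measureReal_apply (measurable_pi_lambda _ (hX n)) hbox]
      congr 1
      ext ω
      simp

end Equivalence


/-! ### Sequences driven by a common input and i.i.d. inputs. -/

section Mixture

variable {Ω E F : Type*} [MeasurableSpace Ω] [MeasurableSpace E] [MeasurableSpace F]
  {P : Measure Ω} [IsProbabilityMeasure P] {Z : Ω → E} {V : Ω → ℕ → F}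
  {τ : Measure F} [IsProbabilityMeasure τ] {g : E × F → ℝ}

/-- The law of `g (z, v)` for fixed `z` and `v` distributed according to `τ`. -/
def sectionLaw (τ : Measure F) [IsProbabilityMeasure τ] (hg : Measurable g) (z : E) :
    ProbabilityMeasure ℝ :=
  ⟨τ.map fun v => g (z, v),
    Measure.isProbabilityMeasure_map (hg.comp measurable_prodMk_left).aemeasurable⟩

lemma sectionLaw_apply (hg : Measurable g) (z : E) {A : Set ℝ} (hA : MeasurableSet A) :
    (sectionLaw τ hg z : Measure ℝ) A = τ {v | g (z, v) ∈ A} :=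
  Measure.map_apply (hg.comp measurable_prodMk_left) hA

lemma measurable_sectionLaw (hg : Measurable g) : Measurable (sectionLaw τ hg) := by
  refine Measurable.subtype_mk (Measure.measurable_of_measurable_coe _ fun A hA => ?_)
  have : (fun z => (τ.map fun v => g (z, v)) A) = fun z => τ (Prod.mk z ⁻¹' (g ⁻¹' A)) := by
    ext z
    exact sectionLaw_apply hg z hA
  rw [this]
  exact measurable_measure_prodMk_left (hg hA)

/-- A sequence that is a function of independent, identically distributed inputs and a common
independent input is exchangeable. -/
lemma exchangeable_of_indepFun (hZ : Measurable Z) (hV : Measurable V) (hZV : IndepFun Z V P)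
    (hVτ : P.map V = Measure.infinitePi fun _ => τ) (hg : Measurable g) :
    Exchangeable P fun i ω => g (Z ω, V ω i) := by
  intro π _
  have hG : Measurable fun p : E × (ℕ → F) => fun i => g (p.1, p.2 i) := by fun_prop
  have hπ : Measurable fun v : ℕ → F => fun i => v (π i) := by fun_prop
  -- A product of copies of one law is invariant under permutation of coordinates.
  have hVπ : (P.map fun ω i => V ω (π i)) = P.map V := by
    have := Measure.map_infinitePi_infinitePi_of_inj (P := fun _ : ℕ => τ) π.injective
    rw [← hVτ, Measure.map_map hπ hV] at this
    exact this
  have hpair : (P.map fun ω => (Z ω, fun i => V ω (π i))) = P.map fun ω => (Z ω, V ω) := by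
    have hind : IndepFun Z (fun ω i => V ω (π i)) P := hZV.comp measurable_id hπ
    have hVm : Measurable fun ω i => V ω (π i) := hπ.comp hV
    rw [hind.map_prod_eq_prod_map_map hZ.aemeasurable hVm.aemeasurable,
      hZV.map_prod_eq_prod_map_map hZ.aemeasurable hV.aemeasurable, hVπ]
  have := congrArg (Measure.map fun p : E × (ℕ → F) => fun i => g (p.1, p.2 i)) hpair
  rwa [Measure.map_map hG (by fun_prop), Measure.map_map hG (by fun_prop)] at this

/-- Such a sequence is directed by the conditional law of its terms given the common input. -/
lemma isDirecting_of_indepFun (hZ : Measurable Z) (hV : Measurable V) (hZV : IndepFun Z V P)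
    (hVτ : P.map V = Measure.infinitePi fun _ => τ) (hg : Measurable g) :
    IsDirecting P (fun i ω => g (Z ω, V ω i)) fun ω => sectionLaw τ hg (Z ω) where
  measurable := (measurable_sectionLaw hg).comp hZ
  condIID s A hA := by
    have hξ : Measurable fun ω => sectionLaw τ hg (Z ω) := (measurable_sectionLaw hg).comp hZ
    have hX : ∀ i, Measurable fun ω => g (Z ω, V ω i) := fun i => by fun_prop
    have hT : MeasurableSet (⋂ i ∈ s, (fun ω => g (Z ω, V ω i)) ⁻¹' A i) :=
      Finset.measurableSet_biInter s fun i _ => hX i (hA i)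
    have hprod : Measurable fun ν : ProbabilityMeasure ℝ => ∏ i ∈ s, (ν : Measure ℝ).real (A i) :=
      Finset.measurable_prod _ fun i _ => measurable_real_apply (hA i)
    have hint : Integrable (fun ω => ∏ i ∈ s, (sectionLaw τ hg (Z ω) : Measure ℝ).real (A i)) P := by
      refine Integrable.of_bound (C := 1) (hprod.comp hξ).aestronglyMeasurable
        (ae_of_all _ fun ω => ?_)
      rw [Real.norm_of_nonneg (Finset.prod_nonneg fun _ _ => measureReal_nonneg)]
      exact Finset.prod_le_one (fun _ _ => measureReal_nonneg) fun _ _ => measureReal_le_one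
    -- Conditioning is on `ξ`, not on `Z`. This is harmless: the product is a function of `ξ`, and
    -- every event of `σ(ξ)` has the form `Z ⁻¹' D'`.
    refine (ae_eq_condExp_of_forall_setIntegral_eq hξ.comap_le
      ((integrable_const 1).indicator hT) (fun _ _ _ => hint.integrableOn) ?_ ?_).symm
    · rintro _ ⟨D, hD, rfl⟩ -
      set D' : Set E := sectionLaw τ hg ⁻¹' D with hD'
      have hDm : MeasurableSet D' := measurable_sectionLaw hg hD
      have hpre : (fun ω => sectionLaw τ hg (Z ω)) ⁻¹' D = Z ⁻¹' D' := rfl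
      rw [hpre, setIntegral_indicator hT, setIntegral_const, smul_eq_mul, mul_one,
        integral_eq_lintegral_of_nonneg_ae
          (ae_of_all _ fun ω => Finset.prod_nonneg fun _ _ => measureReal_nonneg)
          (hprod.comp hξ).aestronglyMeasurable, measureReal_def]
      congr 1
      set B : Set (E × (ℕ → F)) := {p | p.1 ∈ D' ∧ ∀ i ∈ s, g (p.1, p.2 i) ∈ A i} with hB
      have hBm : MeasurableSet B := by
        have : B = Prod.fst ⁻¹' D' ∩
            ⋂ i ∈ s, (fun p : E × (ℕ → F) => g (p.1, p.2 i)) ⁻¹' A i := by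
          ext p; simp [hB]
        rw [this]
        refine (measurable_fst hDm).inter (Finset.measurableSet_biInter s fun i _ => ?_)
        exact (show Measurable fun p : E × (ℕ → F) => g (p.1, p.2 i) by fun_prop) (hA i)
      have hset : Z ⁻¹' D' ∩ ⋂ i ∈ s, (fun ω => g (Z ω, V ω i)) ⁻¹' A i
          = (fun ω => (Z ω, V ω)) ⁻¹' B := by
        ext ω; simp [hB]
      rw [hset, ← Measure.map_apply (hZ.prodMk hV) hBm,
        hZV.map_prod_eq_prod_map_map hZ.aemeasurable hV.aemeasurable, hVτ,
        Measure.prod_apply hBm]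
      -- Fubini: with `z ∈ D'` frozen, the section of `B` is a box, and its measure factorizes.
      have hfun : ∀ z, (Measure.infinitePi fun _ : ℕ => τ) (Prod.mk z ⁻¹' B)
          = D'.indicator (fun z => ENNReal.ofReal
              (∏ i ∈ s, (sectionLaw τ hg z : Measure ℝ).real (A i))) z := by
        intro z
        by_cases hz : z ∈ D'
        · have : Prod.mk z ⁻¹' B = (s : Set ℕ).pi fun i => {v | g (z, v) ∈ A i} := by
            ext v; simp [hB, hz]
          rw [Set.indicator_of_mem hz, this, Measure.infinitePi_pi,
            ENNReal.ofReal_prod_of_nonneg fun _ _ => measureReal_nonneg]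
          · refine Finset.prod_congr rfl fun i _ => ?_
            rw [ofReal_measureReal, sectionLaw_apply hg z (hA i)]
          · exact fun i _ => (hg.comp measurable_prodMk_left) (hA i)
        · have : Prod.mk z ⁻¹' B = ∅ := by
            ext v; simp [hB, hz]
          rw [Set.indicator_of_notMem hz, this, measure_empty]
      rw [lintegral_congr hfun, lintegral_indicator hDm, setLIntegral_map hDm _ hZ]
      exact (hprod.comp (measurable_sectionLaw hg)).ennreal_ofReal
    · exact (hprod.comp (comap_measurable _)).aestronglyMeasurable

end Mixture

/-! ### Existence of the stable law by rescaling. -/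

section StableLaw

/-- Dilation by `σ' / σ` turns scale `σ` into scale `σ'`. The bias law serves as `ν`, so no stable
law has to be constructed. -/
lemma isSymStable_stableLaw {α σ σ' : ℝ} {ν : ProbabilityMeasure ℝ} (hσ : σ ≠ 0)
    (h : IsSymStable α σ (ν : Measure ℝ)) :
    IsSymStable α σ' (stableLaw α σ' : Measure ℝ) := by
  have hex : ∃ μ : ProbabilityMeasure ℝ, IsSymStable α σ' (μ : Measure ℝ) := by
    refine ⟨ν.map (f := fun x => σ' / σ * x) (by fun_prop), fun t => ?_⟩
    rw [ProbabilityMeasure.toMeasure_map]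
    have := charFun_map_smul (μ := (ν : Measure ℝ)) (σ' / σ) t
    simp only [smul_eq_mul] at this
    rw [this, h]
    congr 5
    field_simp
  rw [stableLaw, dif_pos hex]
  exact hex.choose_spec

end StableLaw

/-! ### The network layers as conditionally i.i.d. sequences. -/

namespace Setting

section Measurability

variable {Ω : Type*} {m mΩ : MeasurableSpace Ω} {P : Measure Ω} {L I : ℕ}

/-- The σ-algebra `m` is left free: it is the ambient one for plain measurability, and the one
generated by the parameters of layers up to `k` for independence. -/
lemma measurable_Y_of_le (S : Setting P L I) (n : Fin L → ℕ) (k : ℕ)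
    (hW : ∀ ℓ ∈ Set.Icc 1 k, ∀ i j, Measurable[m] (S.W ℓ i j))
    (hB : ∀ ℓ ∈ Set.Icc 1 k, ∀ i, Measurable[m] (S.B ℓ i)) (i : ℕ) :
    Measurable[m] (S.Y n k i) := by
  induction k generalizing i with
  | zero => exact measurable_const
  | succ k ih =>
    have hW' := hW (k + 1) ⟨by omega, le_rfl⟩
    have hB' := hB (k + 1) ⟨by omega, le_rfl⟩
    cases k with
    | zero =>
      exact (Finset.measurable_sum Finset.univ fun (j : Fin I) _ =>
        (hW' i j).mul_const (S.x j)).add (hB' i)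
    | succ k =>
      have ih' := ih (fun ℓ hℓ => hW ℓ ⟨hℓ.1, hℓ.2.trans (by omega)⟩)
        fun ℓ hℓ => hB ℓ ⟨hℓ.1, hℓ.2.trans (by omega)⟩
      exact ((Finset.measurable_sum _ fun j _ =>
        (hW' i j).mul (S.continuous_φ.measurable.comp (ih' j))).const_mul _).add (hB' i)

end Measurability

variable {Ω : Type*} {mΩ : MeasurableSpace Ω} {P : Measure Ω} {L I : ℕ}

lemma measurable_Y (S : Setting P L I) (n : Fin L → ℕ) {k : ℕ} (hk : k ≤ L + 1) (i : ℕ) :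
    Measurable (S.Y n k i) :=
  S.measurable_Y_of_le n k (fun ℓ hℓ => S.measurable_W ℓ ⟨hℓ.1, hℓ.2.trans hk⟩)
    (fun ℓ hℓ => S.measurable_B ℓ ⟨hℓ.1, hℓ.2.trans hk⟩) i

/-- The bias and the weights of node `i` of layer `ℓ`, as a single sequence. -/
def nodeInput (S : Setting P L I) (ℓ : ℕ) (ω : Ω) (i : ℕ) : ℕ → ℝ
  | 0 => S.B ℓ i ω
  | j + 1 => S.W ℓ i j ω

lemma measurable_nodeInput (S : Setting P L I) {ℓ : ℕ} (hℓ : ℓ ∈ Set.Icc 1 (L + 1)) (i j : ℕ) :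
    Measurable fun ω => S.nodeInput ℓ ω i j := by
  cases j with
  | zero => exact S.measurable_B ℓ hℓ i
  | succ j => exact S.measurable_W ℓ hℓ i j

/-- All weights and biases, as a single family. -/
abbrev parameter (S : Setting P L I) (p : Set.Icc 1 (L + 1) × (ℕ × ℕ ⊕ ℕ)) : Ω → ℝ :=
  Sum.elim (fun q : ℕ × ℕ => S.W p.1 q.1 q.2) (fun i : ℕ => S.B p.1 i) p.2

lemma measurable_parameter (S : Setting P L I) (p : Set.Icc 1 (L + 1) × (ℕ × ℕ ⊕ ℕ)) :
    Measurable (S.parameter p) := by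
  obtain ⟨ℓ, q | i⟩ := p
  exacts [S.measurable_W ℓ ℓ.2 q.1 q.2, S.measurable_B ℓ ℓ.2 i]

lemma map_nodeInput_eq [IsProbabilityMeasure P] (S : Setting P L I) {ℓ : ℕ}
    (hℓ : ℓ ∈ Set.Icc 1 (L + 1)) (i j : ℕ) :
    (P.map fun ω => S.nodeInput ℓ ω i j) = P.map fun ω => S.nodeInput ℓ ω 0 j := by
  cases j with
  | zero =>
    change P.map (S.B ℓ i) = P.map (S.B ℓ 0)
    have h := fun i => Measure.isProbabilityMeasure_map (μ := P) (S.measurable_B ℓ hℓ i).aemeasurable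
    have := h i
    have := h 0
    -- Biases are specified only through their characteristic function, which determines the law.
    refine Measure.ext_of_charFun (funext fun t => ?_)
    rw [S.law_B ℓ hℓ i t, S.law_B ℓ hℓ 0 t]
  | succ j =>
    exact (S.identDistrib_W ℓ hℓ i j).map_eq.trans (S.identDistrib_W ℓ hℓ 0 j).map_eq.symm

lemma iIndepFun_nodeInput (S : Setting P L I) {ℓ : ℕ} (hℓ : ℓ ∈ Set.Icc 1 (L + 1)) :
    iIndepFun (fun (p : ℕ × ℕ) ω => S.nodeInput ℓ ω p.1 p.2) P := by
  let e : ℕ × ℕ → Set.Icc 1 (L + 1) × (ℕ × ℕ ⊕ ℕ) := fun p =>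
    (⟨ℓ, hℓ⟩, Nat.casesOn p.2 (Sum.inr p.1) fun j => Sum.inl (p.1, j))
  have he : e.Injective := by
    rintro ⟨i, _ | j⟩ ⟨i', _ | j'⟩ h <;> simp [e] at h ⊢ <;> omega
  refine (iIndepFun_congr fun p => ?_).1 (S.indep.precomp he)
  obtain ⟨i, _ | j⟩ := p <;> rfl

/-- Independence gives a product measure over pairs `(i, j)`; currying groups it by node, and the
inner law does not depend on the node. -/
lemma map_nodeInput_eq_infinitePi [IsProbabilityMeasure P] (S : Setting P L I) {ℓ : ℕ}
    (hℓ : ℓ ∈ Set.Icc 1 (L + 1)) :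
    P.map (S.nodeInput ℓ) = Measure.infinitePi fun _ : ℕ =>
      Measure.infinitePi fun j => P.map fun ω => S.nodeInput ℓ ω 0 j := by
  have hm := S.measurable_nodeInput hℓ
  have hprob : ∀ i j, IsProbabilityMeasure (P.map fun ω => S.nodeInput ℓ ω i j) := fun i j =>
    Measure.isProbabilityMeasure_map (hm i j).aemeasurable
  have h1 := (S.iIndepFun_nodeInput hℓ).map_fun_eq_infinitePi_map fun (p : ℕ × ℕ) => hm p.1 p.2
  have h2 := Measure.infinitePi_map_curry fun (_ : ℕ) j => P.map fun ω => S.nodeInput ℓ ω 0 j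
  simp_rw [S.map_nodeInput_eq hℓ] at h1
  rw [← h2, ← h1, Measure.map_map (MeasurableEquiv.measurable _)
    (measurable_pi_lambda (fun ω (p : ℕ × ℕ) => S.nodeInput ℓ ω p.1 p.2) fun p => hm p.1 p.2)]
  rfl

/-- The two sides are functions of disjoint blocks of independent parameters: layers up to `k`, and
layer `k + 1`. -/
lemma indepFun_Y_nodeInput (S : Setting P L I) (n : Fin L → ℕ) {k : ℕ} (hk : k + 1 ≤ L + 1) :
    IndepFun (fun ω i => S.Y n k i ω) (S.nodeInput (k + 1)) P := by
  have hle : ∀ p, MeasurableSpace.comap (S.parameter p) inferInstance ≤ mΩ := fun p =>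
    (S.measurable_parameter p).comap_le
  have hind := indep_iSup_of_disjoint hle S.indep.iIndep
    (S := {p | (p.1 : ℕ) ≤ k}) (T := {p | (p.1 : ℕ) = k + 1})
    (Set.disjoint_left.2 fun p hp hp' => by
      simp only [Set.mem_ofPred_eq] at hp hp'; omega)
  have hmeas : ∀ (T : Set (Set.Icc 1 (L + 1) × (ℕ × ℕ ⊕ ℕ))), ∀ p ∈ T,
      Measurable[⨆ p ∈ T, MeasurableSpace.comap (S.parameter p) inferInstance]
        (S.parameter p) := fun T p hp =>
    measurable_iff_comap_le.2 (le_iSup₂_of_le p hp le_rfl)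
  rw [IndepFun_iff_Indep]
  refine indep_of_indep_of_le_left (indep_of_indep_of_le_right hind ?_) ?_
  · refine measurable_iff_comap_le.1 (@measurable_pi_lambda _ _ _ (_) _ _ fun i =>
      @measurable_pi_lambda _ _ _ (_) _ _ fun j => ?_)
    cases j with
    | zero => exact hmeas _ (⟨k + 1, by simp; omega⟩, Sum.inr i) rfl
    | succ j => exact hmeas _ (⟨k + 1, by simp; omega⟩, Sum.inl (i, j)) rfl
  · refine measurable_iff_comap_le.1 (@measurable_pi_lambda _ _ _ (_) _ _ fun i => ?_)
    refine S.measurable_Y_of_le n k (fun ℓ hℓ i j => ?_) (fun ℓ hℓ i => ?_) i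
    · exact hmeas _ (⟨ℓ, hℓ.1, by linarith [hℓ.2]⟩, Sum.inl (i, j)) hℓ.2
    · exact hmeas _ (⟨ℓ, hℓ.1, by linarith [hℓ.2]⟩, Sum.inr i) hℓ.2

/-- The pre-activation value of a node, as a function of the pre-activation values of the previous
layer and of the bias and weights of the node. -/
def nodeMap (S : Setting P L I) (n : Fin L → ℕ) (k : ℕ) (p : (ℕ → ℝ) × (ℕ → ℝ)) : ℝ :=
  1 / S.a (k + 2) (width n (k + 1)) *
    ∑ j ∈ Finset.range (width n (k + 1)), p.2 (j + 1) * S.φ (p.1 j) + p.2 0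

lemma measurable_nodeMap (S : Setting P L I) (n : Fin L → ℕ) (k : ℕ) :
    Measurable (S.nodeMap n k) := by
  have := S.continuous_φ.measurable
  unfold nodeMap
  fun_prop

lemma exchangeable_and_exists_isDirecting [IsProbabilityMeasure P] (S : Setting P L I)
    (n : Fin L → ℕ) {k : ℕ} (hk : k + 2 ≤ L + 1) :
    Exchangeable P (S.Y n (k + 2)) ∧ ∃ ξ, IsDirecting P (S.Y n (k + 2)) ξ := by
  have hℓ : k + 2 ∈ Set.Icc 1 (L + 1) := ⟨by omega, hk⟩
  have hZ : Measurable fun ω i => S.Y n (k + 1) i ω :=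
    measurable_pi_lambda _ (S.measurable_Y n (by omega))
  have hV : Measurable (S.nodeInput (k + 2)) :=
    measurable_pi_lambda _ fun i => measurable_pi_lambda _ (S.measurable_nodeInput hℓ i)
  have hprob : ∀ j, IsProbabilityMeasure (P.map fun ω => S.nodeInput (k + 2) ω 0 j) := fun j =>
    Measure.isProbabilityMeasure_map (S.measurable_nodeInput hℓ 0 j).aemeasurable
  have hind := S.indepFun_Y_nodeInput n (k := k + 1) hk
  have hlaw := S.map_nodeInput_eq_infinitePi hℓ
  exact ⟨exchangeable_of_indepFun hZ hV hind hlaw (S.measurable_nodeMap n k),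
    _, isDirecting_of_indepFun hZ hV hind hlaw (S.measurable_nodeMap n k)⟩

end Setting

end HeavyMLP

end

/-! ### Assembly of the theorem. -/

theorem corollaryA7 {Ω : Type*} [MeasurableSpace Ω] (P : Measure Ω) [IsProbabilityMeasure P]
    (L I : ℕ) (S : HeavyMLP.Setting P L I) (ℓ : ℕ) (hℓ : 3 ≤ ℓ) (hℓL : ℓ ≤ L + 1) :
    -- the objects in the equivalence are as claimed
    HeavyMLP.IsSymStable (S.α (ℓ - 1)) (S.σ (ℓ - 1))
      (HeavyMLP.stableLaw (S.α (ℓ - 1)) (S.σ (ℓ - 1)) : Measure ℝ) ∧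
    (∀ n : Fin L → ℕ, (∀ k, 2 ≤ n k) →
      HeavyMLP.Exchangeable P (S.Y n (ℓ - 1)) ∧
      ∃ ξ : Ω → ProbabilityMeasure ℝ, HeavyMLP.IsDirecting P (S.Y n (ℓ - 1)) ξ) ∧
    -- the equivalence, for every choice of the directing random measures
    ∀ ξ : (Fin L → ℕ) → Ω → ProbabilityMeasure ℝ,
      (∀ n : Fin L → ℕ, (∀ k, 2 ≤ n k) → HeavyMLP.IsDirecting P (S.Y n (ℓ - 1)) (ξ n)) →
      (TendstoInDistribution (fun n ω i => S.Y n (ℓ - 1) i ω) (HeavyMLP.minWidthToInfinity L)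
          (id : (ℕ → ℝ) → (ℕ → ℝ)) (fun _ => P)
          (Measure.infinitePi fun _ : ℕ =>
            (HeavyMLP.stableLaw (S.α (ℓ - 1)) (S.σ (ℓ - 1)) : Measure ℝ)) ↔
        HeavyMLP.TendstoWeaklyInProb P ξ (HeavyMLP.minWidthToInfinity L)
          (HeavyMLP.stableLaw (S.α (ℓ - 1)) (S.σ (ℓ - 1)))) := by
  obtain ⟨k, rfl⟩ : ∃ k, ℓ = k + 3 := ⟨ℓ - 3, by omega⟩
  change k + 3 ≤ L + 1 at hℓL
  have hmem : k + 2 ∈ Set.Icc 1 (L + 1) := ⟨by omega, by omega⟩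
  refine ⟨?_, fun n _ => S.exchangeable_and_exists_isDirecting n hmem.2, fun ξ hξ => ?_⟩
  · exact HeavyMLP.isSymStable_stableLaw (S.σB_pos (k + 2) hmem).ne'
      (ν := ⟨P.map (S.B (k + 2) 0),
        Measure.isProbabilityMeasure_map (S.measurable_B (k + 2) hmem 0).aemeasurable⟩)
      (S.law_B (k + 2) hmem 0)
  · have hY : ∀ n i, Measurable (S.Y n (k + 2) i) := fun n => S.measurable_Y n hmem.2
    have hdir : ∀ᶠ n in HeavyMLP.minWidthToInfinity L,
        HeavyMLP.IsDirecting P (S.Y n (k + 2)) (ξ n) :=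
      -- `ξ n` is directing only for widths at least 2, which holds eventually along the filter.
      Filter.mem_of_superset (Filter.mem_iInf_of_mem 2 (Filter.mem_principal_self _)) hξ
    have : (HeavyMLP.minWidthToInfinity L).IsCountablyGenerated :=
      inferInstanceAs (⨅ N : ℕ, 𝓟 {n : Fin L → ℕ | ∀ k, N ≤ n k}).IsCountablyGenerated
    exact ⟨HeavyMLP.tendstoWeaklyInProb_of_tendstoInDistribution hY hdir,
      HeavyMLP.tendstoInDistribution_of_tendstoWeaklyInProb hY hdir⟩
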